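/- Let $W(\mathbf Z)$ be the group of all bijections $g$ of $\mathbf Z$ such that $\sup\{|g(j)-j| : j\in\mathbf Z\}$ is finite, acting on subsets of $\mathbf Z$ by $g\cdot S=g(S)$, and let $\mathbf N=\{0,1,2,\dots\}\subseteq\mathbf Z$. Call a (discrete) group $H$ amenable if there is a left-invariant mean on $H$, that is, a positive linear functional $m$ on the space $\ell^\infty(H)$ of bounded real-valued functions on $H$ such that $m(1)=1$ and $m(x\mapsto f(hx))=m(f)$ for all $h\in H$ and $f\in\ell^\infty(H)$. Let $G$ be a subgroup of $W(\mathbf Z)$. Suppose that for every finite set $E\subseteq\mathbf Z$ the stabiliser $\{g\in G : g(E\triangle\mathbf N)=E\triangle\mathbf N\}$ of the symmetric difference $E\triangle\mathbf N$ in $G$ is amenable. Then $G$ is amenable. -/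

import Mathlib

open scoped Pointwise symmDiff

/-- The real vector space `ℓ^∞(X)` of bounded real-valued functions on a set `X`. -/
def LInfty (X : Type*) : Submodule ℝ (X → ℝ) where
  carrier := {f | ∃ C : ℝ, ∀ x, |f x| ≤ C}
  zero_mem' := ⟨0, fun x => by simp⟩
  add_mem' := by
    rintro f g ⟨a, ha⟩ ⟨b, hb⟩
    exact ⟨a + b, fun x => (abs_add_le (f x) (g x)).trans (add_le_add (ha x) (hb x))⟩
  smul_mem' := by
    rintro c f ⟨a, ha⟩
    refine ⟨|c| * a, fun x => ?_⟩
    rw [Pi.smul_apply, smul_eq_mul, abs_mul]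
    exact mul_le_mul_of_nonneg_left (ha x) (abs_nonneg c)

/-- The constant function `1` as a bounded function. -/
def LInfty.one (X : Type*) : LInfty X :=
  ⟨fun _ => 1, 1, fun _ => by simp⟩

/-- The pullback `f ↦ f ∘ φ` of bounded functions along a map `φ : Y → X`. -/
def LInfty.comp {X Y : Type*} (f : LInfty X) (φ : Y → X) : LInfty Y :=
  ⟨fun y => f.1 (φ y), f.2.imp fun _ hC y => hC (φ y)⟩

/-- A mean on a set `X`: a positive linear functional on `ℓ^∞(X)` that sends the constant function
`1` to `1`. -/
structure IsMean {X : Type*} (m : LInfty X →ₗ[ℝ] ℝ) : Prop where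
  nonneg : ∀ f : LInfty X, (∀ x, 0 ≤ f.1 x) → 0 ≤ m f
  map_one : m (LInfty.one X) = 1

/-- The action of the group `G` on the set `X` admits an invariant mean. -/
def HasInvariantMean (G X : Type*) [Group G] [MulAction G X] : Prop :=
  ∃ m : LInfty X →ₗ[ℝ] ℝ, IsMean m ∧ ∀ (g : G) (f : LInfty X), m (LInfty.comp f fun x => g • x) = m f

/-- A (discrete) group is amenable if its action on itself by left translations admits an
invariant mean. -/
def IsAmenable (G : Type*) [Group G] : Prop :=
  HasInvariantMean G G

/-- The group `W(ℤ)` of piecewise translations of the integers: all the bijections `g` of `ℤ` for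
which the supremum of `|g j - j|` over `j : ℤ` is finite. -/
def piecewiseTranslations : Subgroup (Equiv.Perm ℤ) where
  carrier := {g | BddAbove (Set.range fun j : ℤ => |g j - j|)}
  one_mem' := ⟨0, by rintro _ ⟨j, rfl⟩; simp⟩
  mul_mem' := by
    rintro g h ⟨a, ha⟩ ⟨b, hb⟩
    refine ⟨a + b, ?_⟩
    rintro _ ⟨j, rfl⟩
    have h1 : |g (h j) - h j| ≤ a := ha ⟨h j, rfl⟩
    have h2 : |h j - j| ≤ b := hb ⟨j, rfl⟩
    have h3 := abs_sub_le (g (h j)) (h j) j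
    simp only [Equiv.Perm.mul_apply]
    linarith
  inv_mem' := by
    rintro g ⟨a, ha⟩
    refine ⟨a, ?_⟩
    rintro _ ⟨j, rfl⟩
    have h1 : |g (g⁻¹ j) - g⁻¹ j| ≤ a := ha ⟨g⁻¹ j, rfl⟩
    have h2 : g (g⁻¹ j) = j := g.apply_symm_apply j
    rw [h2, abs_sub_comm] at h1
    exact h1

/-! Let `G` act on the sets commensurate with `ℕ`, that is, the sets `E ∆ ℕ` with `E` finite. Since
the stabilizers are amenable, averaging their means reduces the claim to an invariant mean on this
set (`IsAmenable.of_hasInvariantMean`), which asymptotically invariant unit vectors in `ℓ²` provide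
(`HasInvariantMean.of_tendsto_affinity`).

These vectors are infinite tensor products of plane vectors `(cos (φ j), sin (φ j))`. Group elements
permute the factors, so the inner product of a vector with its translate is `∏ cos (φ j - φ (g j))`.
Let `φ` climb from `0` to `π / 2` with slope of order `1 / n`. As `g` has bounded displacement,
about `2 n` factors differ from `1`, each by `O(1 / n²)`, and the product tends to `1`. -/

namespace IsMean

variable {X : Type*} {m : LInfty X →ₗ[ℝ] ℝ}

theorem mono (hm : IsMean m) {f g : LInfty X} (h : ∀ x, f.1 x ≤ g.1 x) : m f ≤ m g := by
  have := hm.nonneg (g - f) fun x => sub_nonneg.2 (h x)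
  rw [map_sub] at this
  linarith

theorem abs_le (hm : IsMean m) {f : LInfty X} {C : ℝ} (h : ∀ x, |f.1 x| ≤ C) : |m f| ≤ C := by
  have h1 : ∀ c : ℝ, m (c • LInfty.one X) = c := fun c => by
    rw [map_smul, hm.map_one, smul_eq_mul, mul_one]
  rw [_root_.abs_le]
  constructor
  · rw [← h1 (-C)]
    refine hm.mono fun x => ?_
    simpa [LInfty.one] using (_root_.abs_le.1 (h x)).1
  · rw [← h1 C]
    refine hm.mono fun x => ?_
    simpa [LInfty.one] using (_root_.abs_le.1 (h x)).2

end IsMean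

/-- Averaging a family of means `ν y` on `Y` against a mean `m` on `X`. -/
def LInfty.average {X Y : Type*} (ν : X → LInfty Y →ₗ[ℝ] ℝ) (hν : ∀ x, IsMean (ν x)) :
    LInfty Y →ₗ[ℝ] LInfty X where
  toFun f := ⟨fun x => ν x f, f.2.imp fun _ hC x => (hν x).abs_le hC⟩
  map_add' f g := Subtype.ext <| funext fun x => map_add (ν x) f g
  map_smul' c f := Subtype.ext <| funext fun x => map_smul (ν x) c f

/-- Pullback of bounded functions as a linear map. -/
def LInfty.compLinear {X Y : Type*} (φ : Y → X) : LInfty X →ₗ[ℝ] LInfty Y where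
  toFun f := LInfty.comp f φ
  map_add' _ _ := rfl
  map_smul' _ _ := rfl

/-- A group acting with an invariant mean and with amenable stabilizers is amenable. -/
theorem IsAmenable.of_hasInvariantMean {G X : Type*} [Group G] [MulAction G X]
    (hX : HasInvariantMean G X) (hstab : ∀ x : X, IsAmenable (MulAction.stabilizer G x)) :
    IsAmenable G := by
  obtain ⟨m, hm, hinv⟩ := hX
  choose μ hμ hμinv using hstab
  let push (y : X) (g : G) : LInfty G →ₗ[ℝ] ℝ :=
    μ y ∘ₗ LInfty.compLinear fun h : MulAction.stabilizer G y => g * (h : G)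
  have push_mean (y : X) (g : G) : IsMean (push y g) :=
    ⟨fun f hf => (hμ y).nonneg _ fun h => hf (g * h), (hμ y).map_one⟩
  -- Left invariance of `μ y` makes `push y g` depend only on the coset of `g`, that is, on `g • y`.
  have push_congr {y y' : X} {g g' : G} (hy : y = y') (hg : g • y = g' • y') :
      push y g = push y' g' := by
    subst hy
    ext f
    let k : MulAction.stabilizer G y :=
      ⟨g'⁻¹ * g, by rw [MulAction.mem_stabilizer_iff, mul_smul, hg, inv_smul_smul]⟩
    have := hμinv y k (LInfty.comp f fun h : MulAction.stabilizer G y => g' * (h : G))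
    refine Eq.trans ?_ this
    refine congrArg (μ y) (Subtype.ext <| funext fun h => ?_)
    change f.1 (g * h) = f.1 (g' * ((g'⁻¹ * g) * h))
    group
  -- With `r` constant on orbits, `x ↦ push (r x) (t x)` is equivariant, although `t` is not.
  let r (x : X) : X := Quotient.out (s := MulAction.orbitRel G X) (Quotient.mk _ x)
  have hr (x : X) : ∃ g : G, g • r x = x := by
    have h : (MulAction.orbitRel G X) (r x) x := Quotient.mk_out (s := MulAction.orbitRel G X) x
    exact MulAction.mem_orbit_iff.1 (MulAction.orbitRel_apply.1 ((MulAction.orbitRel G X).symm h))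
  have hr_smul (g : G) (x : X) : r (g • x) = r x :=
    congrArg (Quotient.out (s := MulAction.orbitRel G X)) (Quotient.sound (s := MulAction.orbitRel G X)
      (MulAction.orbitRel_apply.2 ⟨g, rfl⟩))
  choose t ht using hr
  refine ⟨m ∘ₗ LInfty.average (fun x => push (r x) (t x)) fun x => push_mean _ _,
    ⟨fun f hf => hm.nonneg _ fun x => (push_mean _ _).nonneg f hf, ?_⟩, fun k f => ?_⟩
  · refine Eq.trans (congrArg m (Subtype.ext <| funext fun x => ?_)) hm.map_one
    exact (push_mean (r x) (t x)).map_one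
  · refine Eq.trans (congrArg m (Subtype.ext <| funext fun x => ?_)) (hinv k _)
    change push (r x) (t x) (LInfty.comp f fun y => k • y) = push (r (k • x)) (t (k • x)) f
    rw [push_congr (g' := k * t x) (hr_smul k x) (by rw [mul_smul, ht, ht])]
    refine congrArg (μ (r x)) (Subtype.ext <| funext fun h => ?_)
    exact congrArg f.1 (mul_assoc k (t x) h).symm

/-! ### Invariant means from asymptotically invariant vectors -/

open Filter Topology

/-- A sequence of asymptotically invariant means yields an invariant mean. -/
theorem HasInvariantMean.of_tendsto {G X : Type*} [Group G] [MulAction G X]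
    (M : ℕ → LInfty X →ₗ[ℝ] ℝ) (hM : ∀ n, IsMean (M n))
    (hinv : ∀ (g : G) (f : LInfty X),
      Tendsto (fun n => M n (LInfty.comp f fun x => g • x) - M n f) atTop (𝓝 0)) :
    HasInvariantMean G X := by
  have hlim (f : LInfty X) : ∃ a, Tendsto (fun n => M n f) (hyperfilter ℕ) (𝓝 a) := by
    obtain ⟨C, hC⟩ := f.2
    obtain ⟨a, -, ha⟩ := (isCompact_Icc (a := -C) (b := C)).ultrafilter_le_nhds
      ((hyperfilter ℕ).map fun n => M n f)
      (le_principal_iff.2 (Filter.mem_map.2 (Eventually.of_forall fun n => Set.mem_Icc.2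
        (abs_le.1 ((hM n).abs_le hC)))))
    exact ⟨a, ha⟩
  choose m hm using hlim
  refine ⟨⟨⟨m, fun f g => ?_⟩, fun c f => ?_⟩, ⟨fun f hf => ?_, ?_⟩, fun g f => ?_⟩
  · refine tendsto_nhds_unique (hm (f + g)) ?_
    simpa only [map_add] using (hm f).add (hm g)
  · refine tendsto_nhds_unique (hm (c • f)) ?_
    simpa only [map_smul, RingHom.id_apply] using (hm f).const_smul c
  · exact ge_of_tendsto' (hm f) fun n => (hM n).nonneg f hf
  · refine tendsto_nhds_unique (hm (LInfty.one X)) ?_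
    simp only [(hM _).map_one]
    exact tendsto_const_nhds
  · have h := (hm (LInfty.comp f fun x => g • x)).sub (hm f)
    exact sub_eq_zero.1 (tendsto_nhds_unique h
      ((hinv g f).mono_left (Nat.hyperfilter_le_atTop)))

/-- The mean with density `v ^ 2` given by a finitely supported unit vector `v` of `ℓ²(X)`. -/
noncomputable def sqDensityMean {X : Type*} (v : X →₀ ℝ) : LInfty X →ₗ[ℝ] ℝ where
  toFun f := v.sum fun x a => a ^ 2 * f.1 x
  map_add' f g := by simp [Finsupp.sum, mul_add, Finset.sum_add_distrib]
  map_smul' c f := by simp [Finsupp.sum, Finset.mul_sum, mul_left_comm]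

theorem sqDensityMean_apply {X : Type*} (v : X →₀ ℝ) (f : LInfty X) :
    sqDensityMean v f = ∑ᶠ x, v x ^ 2 * f.1 x := by
  rw [finsum_eq_sum_of_support_subset (s := v.support)]
  · rfl
  · intro x hx
    simp only [Function.mem_support, ne_eq, mul_eq_zero, not_or] at hx
    simpa using hx.1

theorem isMean_sqDensityMean {X : Type*} {v : X →₀ ℝ} (hv : ∑ᶠ x, v x ^ 2 = 1) :
    IsMean (sqDensityMean v) where
  nonneg f hf := Finset.sum_nonneg fun x _ => mul_nonneg (sq_nonneg _) (hf x)
  map_one := by simpa [sqDensityMean_apply, LInfty.one] using hv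

/-- The total variation estimate for square densities in terms of their affinity. -/
theorem sq_sqDensityMean_comp_sub_le {G X : Type*} [Group G] [MulAction G X] {v : X →₀ ℝ}
    (hv : ∑ᶠ x, v x ^ 2 = 1) (g : G) (f : LInfty X) {C : ℝ} (hC : ∀ x, |f.1 x| ≤ C) :
    (sqDensityMean v (LInfty.comp f fun x => g • x) - sqDensityMean v f) ^ 2 ≤
      C ^ 2 * (4 * (1 - (∑ᶠ x, v x * v (g • x)) ^ 2)) := by
  classical
  let T : Finset X := v.support ∪ v.support.image fun x => g⁻¹ • x
  have hT (x : X) (hx : x ∉ T) : v x = 0 ∧ v (g • x) = 0 := by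
    simp only [T, Finset.mem_union, Finset.mem_image, not_or, Finsupp.mem_support_iff] at hx
    refine ⟨not_not.1 hx.1, ?_⟩
    by_contra h
    exact hx.2 ⟨g • x, h, inv_smul_smul g x⟩
  have sum_T (F : X → ℝ) (hF : ∀ x, v x = 0 → v (g • x) = 0 → F x = 0) :
      ∑ᶠ x, F x = ∑ x ∈ T, F x := by
    refine finsum_eq_sum_of_support_subset _ fun x hx => ?_
    by_contra h
    exact hx (hF x (hT x h).1 (hT x h).2)
  have e1 : ∑ x ∈ T, v x ^ 2 = 1 := by
    rw [← sum_T _ (by intro x h _; simp [h]), hv]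
  have e2 : ∑ x ∈ T, v (g • x) ^ 2 = 1 := by
    rw [← sum_T (fun x => v (g • x) ^ 2) (by intro x _ h; simp [h]), ← hv]
    exact finsum_comp_equiv (MulAction.toPerm g) (f := fun x => v x ^ 2)
  rw [sum_T _ (by intro x h _; simp [h])]
  -- Reindexing the second mean by `g` gives a difference of squares, whose factors are then
  -- separated by Cauchy–Schwarz.
  have e4 : sqDensityMean v (LInfty.comp f fun x => g • x) - sqDensityMean v f =
      ∑ x ∈ T, (v x - v (g • x)) * ((v x + v (g • x)) * f.1 (g • x)) := by
    have h1 : sqDensityMean v (LInfty.comp f fun x => g • x) = ∑ x ∈ T, v x ^ 2 * f.1 (g • x) := by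
      rw [sqDensityMean_apply]
      exact sum_T _ (by intro x h _; simp [h])
    have h2 : sqDensityMean v f = ∑ x ∈ T, v (g • x) ^ 2 * f.1 (g • x) := by
      rw [sqDensityMean_apply, ← sum_T (fun x => v (g • x) ^ 2 * f.1 (g • x))
        (by intro x _ h; simp [h])]
      exact (finsum_comp_equiv (MulAction.toPerm g) (f := fun x => v x ^ 2 * f.1 x)).symm
    rw [h1, h2, ← Finset.sum_sub_distrib]
    exact Finset.sum_congr rfl fun x _ => by ring
  set a := ∑ x ∈ T, v x * v (g • x) with ha
  have e5 : ∑ x ∈ T, (v x - v (g • x)) ^ 2 = 2 - 2 * a := by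
    simp only [sub_sq, Finset.sum_add_distrib, Finset.sum_sub_distrib, e1, e2, mul_assoc,
      ← Finset.mul_sum, ← ha]
    ring
  have e6 : ∑ x ∈ T, (v x + v (g • x)) ^ 2 = 2 + 2 * a := by
    simp only [add_sq, Finset.sum_add_distrib, e1, e2, mul_assoc, ← Finset.mul_sum, ← ha]
    ring
  have e7 : ∑ x ∈ T, ((v x + v (g • x)) * f.1 (g • x)) ^ 2 ≤ C ^ 2 * (2 + 2 * a) := by
    rw [← e6, Finset.mul_sum]
    refine Finset.sum_le_sum fun x _ => ?_
    rw [mul_pow, mul_comm]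
    exact mul_le_mul_of_nonneg_right (sq_le_sq' (abs_le.1 (hC _)).1 (abs_le.1 (hC _)).2)
      (sq_nonneg _)
  have e8 : 0 ≤ 2 - 2 * a := e5 ▸ Finset.sum_nonneg fun x _ => sq_nonneg _
  rw [e4]
  calc _ ≤ _ := Finset.sum_mul_sq_le_sq_mul_sq _ _ _
    _ ≤ (2 - 2 * a) * (C ^ 2 * (2 + 2 * a)) := by
      rw [e5]
      exact mul_le_mul_of_nonneg_left e7 e8
    _ = _ := by ring

/-- Asymptotically invariant unit vectors in `ℓ²(X)` yield an invariant mean. -/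
theorem HasInvariantMean.of_tendsto_affinity {G X : Type*} [Group G] [MulAction G X]
    (v : ℕ → X →₀ ℝ) (hv : ∀ n, ∑ᶠ x, v n x ^ 2 = 1)
    (hinv : ∀ g : G, Tendsto (fun n => ∑ᶠ x, v n x * v n (g • x)) atTop (𝓝 1)) :
    HasInvariantMean G X := by
  refine .of_tendsto (fun n => sqDensityMean (v n)) (fun n => isMean_sqDensityMean (hv n))
    fun g f => ?_
  obtain ⟨C, hC⟩ := f.2
  have h0 : Tendsto (fun n => C ^ 2 * (4 * (1 - (∑ᶠ x, v n x * v n (g • x)) ^ 2))) atTop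
      (𝓝 0) := by
    simpa using ((((hinv g).pow 2).const_sub 1).const_mul 4).const_mul (C ^ 2)
  have h1 := squeeze_zero (fun n => sq_nonneg _)
    (fun n => sq_sqDensityMean_comp_sub_le (hv n) g f hC) h0
  rw [tendsto_zero_iff_abs_tendsto_zero]
  have h2 := h1.sqrt
  simpa only [Real.sqrt_sq_eq_abs, Real.sqrt_zero, Function.comp_def] using h2


/-! ### Product vectors on commensurate sets -/

section Commensurate

variable {G ι : Type*} [Group G] [MulAction G ι]

/-- The sets commensurate with `A`, on which `G` acts as soon as it commensurates `A`. -/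
def commensurateSets {A : Set ι} (hA : ∀ g : G, ((g • A) ∆ A).Finite) :
    SubMulAction G (Set ι) where
  carrier := {S | (S ∆ A).Finite}
  smul_mem' g S hS := by
    refine ((hS.smul_set (a := g)).union (hA g)).subset ?_
    rw [Set.smul_set_symmDiff]
    exact symmDiff_triangle _ _ _

theorem finite_symmDiff_of_commensurateSets {A : Set ι} (hA : ∀ g : G, ((g • A) ∆ A).Finite)
    (S : commensurateSets hA) : (S.1 ∆ A).Finite :=
  S.2

/-- Finite sets parametrize the sets commensurate with `A`, by symmetric difference with `A`. -/
noncomputable def commensurateSetsEquiv {A : Set ι} (hA : ∀ g : G, ((g • A) ∆ A).Finite) :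
    Finset ι ≃ commensurateSets hA where
  toFun E := ⟨(E : Set ι) ∆ A, by
    change (((E : Set ι) ∆ A) ∆ A).Finite
    rw [symmDiff_symmDiff_cancel_right]
    exact E.finite_toSet⟩
  invFun S := (finite_symmDiff_of_commensurateSets hA S).toFinset
  left_inv E := by
    ext j
    simp
  right_inv S := by
    refine Subtype.ext ?_
    change ((finite_symmDiff_of_commensurateSets hA S).toFinset : Set ι) ∆ A = S.1
    rw [Set.Finite.coe_toFinset, symmDiff_symmDiff_cancel_right]

open Classical in
/-- The amplitude at `S` of the product vector whose factor at `j` is `(cos (φ j), sin (φ j))`,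
the second entry corresponding to `j ∈ S`. -/
noncomputable def angleAmplitude (φ : ι → ℝ) (S : Set ι) : ℝ :=
  ∏ᶠ j, if j ∈ S then Real.sin (φ j) else Real.cos (φ j)

theorem angleAmplitude_smul (φ : ι → ℝ) (g : G) (S : Set ι) :
    angleAmplitude φ (g • S) = angleAmplitude (fun j => φ (g • j)) S := by
  classical
  refine (finprod_comp_equiv (MulAction.toPerm g)).symm.trans (finprod_congr fun j => ?_)
  simp only [MulAction.toPerm_apply, Set.smul_mem_smul_set_iff]

/-- Off `F`, the angle `φ` is the one whose product vector is the Dirac mass at `A`. -/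
def AngleStandardOff (A : Set ι) (F : Finset ι) (φ : ι → ℝ) : Prop :=
  ∀ j ∉ F, (j ∈ A → φ j = Real.pi / 2) ∧ (j ∉ A → φ j = 0)

theorem AngleStandardOff.amplitude_eq_zero {A : Set ι} {F E : Finset ι} {φ : ι → ℝ}
    (hφ : AngleStandardOff A F φ) (hE : ¬ E ⊆ F) : angleAmplitude φ ((E : Set ι) ∆ A) = 0 := by
  classical
  obtain ⟨j, hjE, hjF⟩ := Finset.not_subset.1 hE
  -- The factor at `j ∈ E \ F` vanishes. Finite support must be checked as well, because `finprod`
  -- defaults to `1` without it.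
  refine finprod_eq_zero _ j ?_ ((E ∪ F).finite_toSet.subset fun i hi => ?_)
  · by_cases hj : j ∈ A
    · simp [Set.mem_symmDiff, hj, hjE, (hφ j hjF).1 hj]
    · simp [Set.mem_symmDiff, hj, hjE, (hφ j hjF).2 hj]
  · by_contra h
    simp only [Finset.coe_union, Set.mem_union, SetLike.mem_coe, not_or] at h
    refine hi ?_
    by_cases hj : i ∈ A
    · simp [Set.mem_symmDiff, hj, h.1, (hφ i h.2).1 hj]
    · simp [Set.mem_symmDiff, hj, h.1, (hφ i h.2).2 hj]

open Classical in
theorem AngleStandardOff.amplitude_eq_prod {A : Set ι} {F E : Finset ι} {φ : ι → ℝ}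
    (hφ : AngleStandardOff A F φ) (hE : E ⊆ F) :
    angleAmplitude φ ((E : Set ι) ∆ A) =
      (∏ j ∈ E, if j ∈ A then Real.cos (φ j) else Real.sin (φ j)) *
        ∏ j ∈ F \ E, if j ∈ A then Real.sin (φ j) else Real.cos (φ j) := by
  rw [angleAmplitude, finprod_eq_prod_of_mulSupport_subset (s := F), mul_comm,
    ← Finset.prod_sdiff hE]
  · congr 1
    · refine Finset.prod_congr rfl fun j hj => ?_
      have := (Finset.mem_sdiff.1 hj).2
      by_cases hA : j ∈ A <;> simp [Set.mem_symmDiff, this, hA]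
    · refine Finset.prod_congr rfl fun j hj => ?_
      by_cases hA : j ∈ A <;> simp [Set.mem_symmDiff, hj, hA]
  · intro i hi
    by_contra h
    have hE' : i ∉ E := fun h' => h (hE h')
    refine hi ?_
    by_cases hj : i ∈ A
    · simp [Set.mem_symmDiff, hj, hE', (hφ i h).1 hj]
    · simp [Set.mem_symmDiff, hj, hE', (hφ i h).2 hj]

/-- The affinity of two product vectors is the product of the cosines of the angle differences. -/
theorem finsum_amplitude_mul_amplitude {A : Set ι} (hA : ∀ g : G, ((g • A) ∆ A).Finite)
    {F : Finset ι} {φ ψ : ι → ℝ} (hφ : AngleStandardOff A F φ) (hψ : AngleStandardOff A F ψ) :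
    ∑ᶠ S : commensurateSets hA, angleAmplitude φ S * angleAmplitude ψ S =
      ∏ j ∈ F, Real.cos (φ j - ψ j) := by
  classical
  rw [← finsum_comp_equiv (commensurateSetsEquiv hA),
    finsum_eq_sum_of_support_subset (s := F.powerset)]
  · have h (j : ι) : Real.cos (φ j - ψ j) =
        (if j ∈ A then Real.cos (φ j) else Real.sin (φ j)) *
          (if j ∈ A then Real.cos (ψ j) else Real.sin (ψ j)) +
        (if j ∈ A then Real.sin (φ j) else Real.cos (φ j)) *
          (if j ∈ A then Real.sin (ψ j) else Real.cos (ψ j)) := by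
      rw [Real.cos_sub]
      split_ifs
      · rfl
      · exact add_comm _ _
    -- Expanding the product of two-term sums gives one summand for each `E ⊆ F`.
    simp only [h, Finset.prod_add]
    refine Finset.sum_congr rfl fun E hE => ?_
    have hE := Finset.mem_powerset.1 hE
    change angleAmplitude φ ((E : Set ι) ∆ A) * angleAmplitude ψ ((E : Set ι) ∆ A) = _
    rw [hφ.amplitude_eq_prod hE, hψ.amplitude_eq_prod hE, Finset.prod_mul_distrib,
      Finset.prod_mul_distrib]
    ring
  · intro E hE
    by_contra h
    refine hE ?_
    change angleAmplitude φ ((E : Set ι) ∆ A) * _ = 0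
    rw [hφ.amplitude_eq_zero (by simpa using h), zero_mul]

/-- The sets commensurate with `A` carry an invariant mean if there are angles, standard off finite
sets, whose variation under each group element tends to zero in the product sense. -/
theorem hasInvariantMean_commensurateSets {A : Set ι} (hA : ∀ g : G, ((g • A) ∆ A).Finite)
    (φ : ℕ → ι → ℝ) (hφ : ∀ n, ∃ F, AngleStandardOff A F (φ n))
    (hlim : ∀ g : G, ∃ F : ℕ → Finset ι, (∀ n, AngleStandardOff A (F n) (φ n)) ∧
      (∀ n, AngleStandardOff A (F n) fun j => φ n (g • j)) ∧
      Tendsto (fun n => ∏ j ∈ F n, Real.cos (φ n j - φ n (g • j))) atTop (𝓝 1)) :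
    HasInvariantMean G (commensurateSets hA) := by
  have hone (n : ℕ) : ∑ᶠ S : commensurateSets hA, angleAmplitude (φ n) S ^ 2 = 1 := by
    obtain ⟨F, hF⟩ := hφ n
    simp only [sq, finsum_amplitude_mul_amplitude hA hF hF, sub_self, Real.cos_zero,
      Finset.prod_const_one]
  have hfin (n : ℕ) :
      (Function.support fun S : commensurateSets hA => angleAmplitude (φ n) S).Finite := by
    by_contra h
    -- A `finsum` with infinite support is `0`, so norm `1` already forces finite support.
    refine one_ne_zero (α := ℝ) ((hone n).symm.trans (finsum_of_infinite_support ?_))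
    simpa [Function.support] using h
  refine .of_tendsto_affinity (fun n => Finsupp.ofSupportFinite _ (hfin n)) hone fun g => ?_
  obtain ⟨F, h1, h2, h3⟩ := hlim g
  refine h3.congr fun n => ?_
  rw [← finsum_amplitude_mul_amplitude hA (h1 n) (h2 n)]
  refine finsum_congr fun S => ?_
  rw [← angleAmplitude_smul]
  rfl

end Commensurate

/-- The Weierstrass product inequality. -/
theorem Finset.one_sub_sum_one_sub_le_prod {ι : Type*} (s : Finset ι) (f : ι → ℝ)
    (h0 : ∀ i ∈ s, 0 ≤ f i) (h1 : ∀ i ∈ s, f i ≤ 1) :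
    1 - ∑ i ∈ s, (1 - f i) ≤ ∏ i ∈ s, f i := by
  classical
  induction s using Finset.induction_on with
  | empty => simp
  | insert a s ha ih =>
    have ih := ih (fun i hi => h0 i (Finset.mem_insert_of_mem hi))
      fun i hi => h1 i (Finset.mem_insert_of_mem hi)
    have hp : ∏ i ∈ s, f i ≤ 1 := Finset.prod_le_one
      (fun i hi => h0 i (Finset.mem_insert_of_mem hi))
      fun i hi => h1 i (Finset.mem_insert_of_mem hi)
    have ha1 := h1 a (Finset.mem_insert_self a s)
    rw [Finset.sum_insert ha, Finset.prod_insert ha]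
    nlinarith [mul_nonneg (sub_nonneg.2 ha1) (sub_nonneg.2 hp)]

/-! ### Ramp angles and bounded displacement -/

/-- An angle increasing linearly from `0` at `-(n + 1)` to `π / 2` at `n + 1`. -/
noncomputable def rampAngle (n : ℕ) (j : ℤ) : ℝ :=
  Real.pi / 4 + Real.pi / 4 * max (-1) (min 1 ((j : ℝ) / (n + 1)))

theorem rampAngle_nonneg (n : ℕ) (j : ℤ) : 0 ≤ rampAngle n j := by
  have := le_max_left (-1) (min 1 ((j : ℝ) / (n + 1)))
  unfold rampAngle
  nlinarith [Real.pi_pos]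

theorem rampAngle_le (n : ℕ) (j : ℤ) : rampAngle n j ≤ Real.pi / 2 := by
  have : max (-1) (min 1 ((j : ℝ) / (n + 1))) ≤ 1 := max_le (by norm_num) (min_le_left _ _)
  unfold rampAngle
  nlinarith [Real.pi_pos]

theorem abs_rampAngle_sub_le (n : ℕ) (i j : ℤ) :
    |rampAngle n i - rampAngle n j| ≤ |(i : ℝ) - j| / (n + 1) := by
  have hn : (0 : ℝ) < n + 1 := by positivity
  have h1 : |max (-1) (min 1 ((i : ℝ) / (n + 1))) - max (-1) (min 1 ((j : ℝ) / (n + 1)))| ≤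
      |(i : ℝ) - j| / (n + 1) := by
    rw [← abs_of_pos hn, ← abs_div, abs_of_pos hn, sub_div]
    refine (abs_max_sub_max_le_max _ _ _ _).trans ?_
    rw [sub_self, abs_zero]
    refine max_le (abs_nonneg _) ((abs_min_sub_min_le_max _ _ _ _).trans ?_)
    rw [sub_self, abs_zero]
    exact max_le (abs_nonneg _) le_rfl
  rw [rampAngle, rampAngle, add_sub_add_left_eq_sub, ← mul_sub, abs_mul,
    abs_of_pos (by positivity)]
  refine (mul_le_of_le_one_left (abs_nonneg _) ?_).trans h1
  linarith [Real.pi_lt_four]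

theorem rampAngle_of_le {n : ℕ} {j : ℤ} (h : (n : ℤ) + 1 ≤ j) : rampAngle n j = Real.pi / 2 := by
  have h' : (1 : ℝ) ≤ j / (n + 1) := by
    rw [one_le_div (by positivity)]
    exact_mod_cast h
  rw [rampAngle, min_eq_left h', max_eq_right (by norm_num)]
  ring

theorem rampAngle_of_le_neg {n : ℕ} {j : ℤ} (h : j ≤ -((n : ℤ) + 1)) : rampAngle n j = 0 := by
  have h' : (j : ℝ) / (n + 1) ≤ -1 := by
    rw [div_le_iff₀ (by positivity)]
    have : (j : ℝ) ≤ -(n + 1) := by exact_mod_cast h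
    linarith
  rw [rampAngle, max_eq_left ((min_le_right _ _).trans h')]
  ring

/-- Widening the ramp's window by `C` ensures that `g` cannot carry an outside point back into the
ramp. -/
theorem angleStandardOff_rampAngle_comp {g : ℤ → ℤ} {C : ℕ} (hg : ∀ j, |g j - j| ≤ C) (n : ℕ) :
    AngleStandardOff {j : ℤ | 0 ≤ j} (Finset.Icc (-(n + 1 + C : ℤ)) (n + 1 + C))
      fun j => rampAngle n (g j) := by
  intro j hj
  have h := abs_le.1 (hg j)
  simp only [Finset.mem_Icc, not_and_or, not_le] at hj
  simp only [Set.mem_ofPred_eq]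
  exact ⟨fun _ => rampAngle_of_le (by omega), fun _ => rampAngle_of_le_neg (by omega)⟩

theorem tendsto_prod_cos_rampAngle {g : ℤ → ℤ} {C : ℕ} (hg : ∀ j, |g j - j| ≤ C) :
    Tendsto (fun n : ℕ => ∏ j ∈ Finset.Icc (-(n + 1 + C : ℤ)) (n + 1 + C),
      Real.cos (rampAngle n j - rampAngle n (g j))) atTop (𝓝 1) := by
  have h0 (n : ℕ) (j : ℤ) : 0 ≤ Real.cos (rampAngle n j - rampAngle n (g j)) := by
    refine Real.cos_nonneg_of_mem_Icc ⟨?_, ?_⟩ <;>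
    linarith [rampAngle_nonneg n j, rampAngle_le n j, rampAngle_nonneg n (g j),
      rampAngle_le n (g j)]
  have h1 (n : ℕ) (j : ℤ) :
      1 - Real.cos (rampAngle n j - rampAngle n (g j)) ≤ (C / (n + 1) : ℝ) ^ 2 / 2 := by
    have h2 : |rampAngle n j - rampAngle n (g j)| ≤ C / (n + 1) := by
      refine (abs_rampAngle_sub_le n j (g j)).trans ?_
      have : |(j : ℝ) - g j| ≤ C := by
        rw [abs_sub_comm]
        exact_mod_cast hg j
      gcongr
    have h3 := sq_le_sq' (abs_le.1 h2).1 (abs_le.1 h2).2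
    linarith [Real.one_sub_sq_div_two_le_cos (x := rampAngle n j - rampAngle n (g j))]
  -- The subtracted term is `(2 (n + 1 + C) + 1) * (C / (n + 1)) ^ 2 / 2`, the number of factors
  -- times the bound `h1`, in powers of `1 / (n + 1)`.
  have hlim : Tendsto (fun n : ℕ => 1 - ((C : ℝ) ^ 2 * (1 / ((n : ℝ) + 1)) +
      (2 * C + 1) * C ^ 2 / 2 * (1 / ((n : ℝ) + 1)) ^ 2)) atTop (𝓝 1) := by
    have h := tendsto_one_div_add_atTop_nhds_zero_nat (𝕜 := ℝ)
    simpa using ((h.const_mul ((C : ℝ) ^ 2)).add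
      ((h.pow 2).const_mul ((2 * C + 1) * (C : ℝ) ^ 2 / 2))).const_sub 1
  refine tendsto_of_tendsto_of_tendsto_of_le_of_le hlim tendsto_const_nhds (fun n => ?_) fun n =>
    Finset.prod_le_one (fun j _ => h0 n j) fun j _ => Real.cos_le_one _
  refine le_trans ?_ (Finset.one_sub_sum_one_sub_le_prod _ _ (fun j _ => h0 n j)
    fun j _ => Real.cos_le_one _)
  refine sub_le_sub_left ((Finset.sum_le_card_nsmul _ _ _ fun j _ => h1 n j).trans_eq ?_) _
  have hcard : ((Finset.Icc (-(n + 1 + C : ℤ)) (n + 1 + C)).card : ℝ) =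
      2 * (n + 1 + C) + 1 := by
    rw [Int.card_Icc]
    have : ((n + 1 + C + 1 - -(n + 1 + C) : ℤ).toNat) = 2 * (n + 1 + C) + 1 := by omega
    rw [this]
    push_cast
    ring
  rw [nsmul_eq_mul, hcard]
  field_simp
  ring

/-- A permutation of bounded displacement commensurates the natural numbers. -/
theorem finite_image_symmDiff_of_abs_sub_le {g : Equiv.Perm ℤ} {C : ℕ}
    (hg : ∀ j, |g j - j| ≤ C) :
    ((g '' {j : ℤ | 0 ≤ j}) ∆ {j : ℤ | 0 ≤ j}).Finite := by
  refine (Set.finite_Icc (-(C : ℤ)) C).subset ?_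
  rintro j (⟨⟨i, hi, rfl⟩, h⟩ | ⟨h, h'⟩)
  · have := abs_le.1 (hg i)
    simp only [Set.mem_ofPred_eq] at hi h
    exact ⟨by omega, by omega⟩
  · have h1 := abs_le.1 (hg (g.symm j))
    rw [Equiv.apply_symm_apply] at h1
    have h2 : ¬ 0 ≤ g.symm j := fun h2 => h' ⟨_, h2, g.apply_symm_apply j⟩
    simp only [Set.mem_ofPred_eq] at h
    exact ⟨by omega, by omega⟩

theorem piecewiseTranslations_exists_bound (g : piecewiseTranslations) :
    ∃ C : ℕ, ∀ j, |g.1 j - j| ≤ C := by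
  obtain ⟨c, hc⟩ := g.2
  exact ⟨c.toNat, fun j => (hc ⟨j, rfl⟩).trans (Int.self_le_toNat c)⟩

/-- The natural numbers in `ℤ` are `{n | 0 ≤ n}`. The group `G` acts on subsets of `ℤ` by
`g • S = g(S)`, and the stabilizer is that of the set `E ∆ ℕ` as a point of `Set ℤ`. -/
theorem proposition3p3 (G : Subgroup piecewiseTranslations)
    (hG : ∀ E : Finset ℤ,
      IsAmenable (MulAction.stabilizer G ((E : Set ℤ) ∆ {n : ℤ | 0 ≤ n}))) :
    IsAmenable G := by
  choose C hC using fun g : G => piecewiseTranslations_exists_bound g.1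
  have hA (g : G) : ((g • {j : ℤ | 0 ≤ j}) ∆ {j : ℤ | 0 ≤ j}).Finite :=
    finite_image_symmDiff_of_abs_sub_le (hC g)
  -- Giving `id` the bound `C g` puts the angle and its translate in the same window.
  have hid (c : ℕ) (j : ℤ) : |id j - j| ≤ c := by simp
  refine IsAmenable.of_hasInvariantMean (X := commensurateSets hA)
    (hasInvariantMean_commensurateSets hA rampAngle
      (fun n => ⟨_, angleStandardOff_rampAngle_comp (hid 0) n⟩) fun g =>
      ⟨_, angleStandardOff_rampAngle_comp (hid (C g)), angleStandardOff_rampAngle_comp (hC g),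
        tendsto_prod_cos_rampAngle (hC g)⟩) fun S => ?_
  obtain ⟨E, rfl⟩ := (commensurateSetsEquiv hA).surjective S
  rw [SubMulAction.stabilizer_of_subMul]
  exact hG E
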